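/- Let $R$ be a commutative Noetherian ring with non-zero identity, $\mathfrak a$ an ideal of $R$, $N$ a finitely generated $R$-module that is $\mathfrak a$-torsion (every element of $N$ is annihilated by some power of $\mathfrak a$), and $X$ an arbitrary $R$-module. For $i\ge 0$ let $H^i_{\mathfrak a}$ denote the $i$-th local cohomology functor, i.e. the $i$-th right derived functor of the $\mathfrak a$-torsion functor $\Gamma_{\mathfrak a}(M)=\{x\in M : \mathfrak a^n x=0 \text{ for some } n\ge 0\}$. Let $s,t$ be non-negative integers such that (i) $\operatorname{Ext}^{s+t-i}_R(N, H^i_{\mathfrak a}(X))=0$ for all $i$ with $0\le i<t$ or $t<i\le s+t$; (ii) $\operatorname{Ext}^{s+t+1-i}_R(N, H^i_{\mathfrak a}(X))=0$ for all $i$ with $0\le i<t$; and (iii) $\operatorname{Ext}^{s+t-1-i}_R(N, H^i_{\mathfrak a}(X))=0$ for all $i$ with $t+1\le i<s+t$. Then there is an isomorphism of $R$-modules $\operatorname{Ext}^s_R(N, H^t_{\mathfrak a}(X))\cong \operatorname{Ext}^{s+t}_R(N, X)$. -/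

import Mathlib

open CategoryTheory

universe v u

noncomputable section

namespace LocalCoh

variable {R : Type u} [CommRing R] (a : Ideal R)

/-- The `a`-torsion functor `Γ_a` on `R`-modules: `Γ_a(M)` is the submodule of all `x : M` that are
annihilated by some power of `a` (the union of the annihilators `(0 :_M a ^ n)`), and
`Γ_a(f)` is the restriction of `f`. -/
def torsionFunctor : ModuleCat.{v} R ⥤ ModuleCat.{v} R where
  obj M := ModuleCat.of R (a.primaryComponent M)
  map f := ModuleCat.ofHom (Ideal.primaryComponent.map a f.hom)

instance : (torsionFunctor.{v} a).Additive where

/-- The `i`-th local cohomology functor `H^i_a` with support in `a`: the `i`-th right derived functor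
of the `a`-torsion functor `Γ_a`. -/
def localCohomologyFunctor [Small.{v} R] (i : ℕ) : ModuleCat.{v} R ⥤ ModuleCat.{v} R :=
  (torsionFunctor.{v} a).rightDerived i

/-- The module `M` is `a`-torsion: `Γ_a(M) = M`, that is, every element of `M` is annihilated
by some power of `a`. -/
def IsIdealTorsion (M : Type v) [AddCommGroup M] [Module R M] : Prop :=
  a.primaryComponent M = ⊤

end LocalCoh

end

-- Let `I` be an injective resolution of `X` and `Y` the class of Γ_a(I) in the derived category, so
-- the homology of `Y` is H^i_a(X). As `R` is Noetherian, Γ_a preserves injectives (Artin–Rees and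
-- Baer), so Γ_a(I) is K-injective. As `N` is torsion, every map from `N` to a term of I lands in
-- Γ_a, hence Hom(N, Y⟦n⟧) ≅ Ext^n(N, X). Truncations of `Y` then replace the spectral sequence
-- Ext^p(N, H^q_a(X)) ⇒ Ext^{p+q}(N, X). With n = s + t, (i) and (ii) kill maps from `N` to the part
-- below `t` shifted by n and n + 1; (i) and (iii) kill those to the part above `t` shifted by n and
-- n - 1. Two long exact sequences leave only H^t (`nonempty_linearEquiv_hom_shift`).

universe w' w

/-! ### Torsion submodules and injectivity. -/

namespace LocalCoh

variable {R : Type u} [CommRing R] (a : Ideal R)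

lemma mem_primaryComponent_iff {M : Type*} [AddCommGroup M] [Module R M] (x : M) :
    x ∈ a.primaryComponent M ↔ ∃ n : ℕ, ∀ r ∈ a ^ n, r • x = 0 := by
  simp [Ideal.primaryComponent_mem]

/-- A finitely generated `a`-torsion module is killed by a power of `a`. -/
lemma exists_pow_smul_eq_zero_of_fg {M : Type*} [AddCommGroup M] [Module R M]
    (S : Submodule R M) (hS : S.FG) (h : S ≤ a.primaryComponent M) :
    ∃ n : ℕ, ∀ r ∈ a ^ n, ∀ x ∈ S, r • x = 0 := by
  induction S, hS using Submodule.fg_induction with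
  | singleton x =>
    obtain ⟨n, hn⟩ := (mem_primaryComponent_iff a x).1 (h (Submodule.mem_span_singleton_self x))
    refine ⟨n, fun r hr y hy => ?_⟩
    obtain ⟨c, rfl⟩ := Submodule.mem_span_singleton.1 hy
    rw [smul_comm, hn r hr, smul_zero]
  | sup S₁ _ S₂ _ h₁ h₂ =>
    obtain ⟨n₁, hn₁⟩ := h₁ (le_sup_left.trans h)
    obtain ⟨n₂, hn₂⟩ := h₂ (le_sup_right.trans h)
    refine ⟨n₁ + n₂, fun r hr x hx => ?_⟩
    obtain ⟨y, hy, z, hz, rfl⟩ := Submodule.mem_sup.1 hx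
    rw [smul_add, hn₁ r (Ideal.pow_le_pow_right (Nat.le_add_right _ _) hr) y hy,
      hn₂ r (Ideal.pow_le_pow_right (Nat.le_add_left _ _) hr) z hz, add_zero]

/-- Over a Noetherian ring, the `a`-torsion submodule of an injective module satisfies
Baer's criterion. -/
lemma baer_primaryComponent [IsNoetherianRing R] {M : Type*} [AddCommGroup M] [Module R M]
    (hM : Module.Baer R M) : Module.Baer R (a.primaryComponent M) := by
  intro J f
  let g : J →ₗ[R] M := (a.primaryComponent M).subtype ∘ₗ f
  obtain ⟨k, hk⟩ := exists_pow_smul_eq_zero_of_fg a (LinearMap.range g)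
    (LinearMap.range_eq_map g ▸ (IsNoetherian.noetherian (⊤ : Submodule R J)).map g)
    (by rintro _ ⟨x, rfl⟩; exact (f x).2)
  -- Artin–Rees: `a ^ (m + k) ⊓ J` lies in `a ^ k • J`, where `g` vanishes.
  obtain ⟨m, hm⟩ := Ideal.exists_pow_inf_eq_pow_smul a (M := R) J
  let P : Ideal R := a ^ (m + k)
  have hP : ∀ x : J, (x : R) ∈ P → g x = 0 := by
    intro x hx
    have h1 : (x : R) ∈ a ^ k • (a ^ m • (⊤ : Submodule R R) ⊓ J) := by
      have := hm (m + k) (Nat.le_add_right _ _)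
      rw [Nat.add_sub_cancel_left] at this
      rw [← this]
      exact ⟨by simpa [P] using hx, x.2⟩
    have h2 : (x : R) ∈ a ^ k • J := Submodule.smul_mono le_rfl inf_le_right h1
    have h3 : x ∈ a ^ k • (⊤ : Submodule R J) := by
      have : (a ^ k • (⊤ : Submodule R J)).map J.subtype = a ^ k • J := by
        rw [Submodule.map_smul'']; simp
      rw [← this] at h2
      obtain ⟨y, hy, hxy⟩ := h2
      rwa [← Subtype.ext hxy]
    refine Submodule.smul_induction_on h3 (fun r hr y _ => ?_) (fun y z hy hz => ?_)
    · rw [map_smul]; exact hk r hr _ ⟨y, rfl⟩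
    · rw [map_add, hy, hz, add_zero]
  -- So `g` factors through `J ⧸ J'`, which embeds in `R ⧸ P`. An extension to `R ⧸ P` has values
  -- killed by `P`, hence torsion.
  let J' : Submodule R J := Submodule.comap J.subtype P
  let g' : (J ⧸ J') →ₗ[R] M := J'.liftQ g (fun x hx => hP x hx)
  let i : (J ⧸ J') →ₗ[R] (R ⧸ P) := J'.mapQ P J.subtype le_rfl
  have hi : Function.Injective i := by
    rw [← LinearMap.ker_eq_bot, Submodule.ker_mapQ]
    exact Submodule.mkQ_map_self J'
  obtain ⟨h, hh⟩ := hM.extension_property i hi g'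
  let e : R →ₗ[R] M := h ∘ₗ P.mkQ
  have he : ∀ x, e x ∈ a.primaryComponent M := fun x => by
    rw [mem_primaryComponent_iff]
    refine ⟨m + k, fun r hr => ?_⟩
    rw [← map_smul, smul_eq_mul]
    have : P.mkQ (r * x) = 0 := by
      rw [Submodule.mkQ_apply, Submodule.Quotient.mk_eq_zero]
      exact P.mul_mem_right _ hr
    simp only [e, LinearMap.comp_apply, this, map_zero]
  refine ⟨e.codRestrict _ he, fun x hx => Subtype.ext ?_⟩
  exact LinearMap.congr_fun hh (J'.mkQ ⟨x, hx⟩)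

instance [IsNoetherianRing R] [Small.{v} R] (I : ModuleCat.{v} R) [Injective I] :
    Injective ((torsionFunctor.{v} a).obj I) := by
  have : Module.Injective R I := Module.injective_module_of_injective_object R I
  have := (baer_primaryComponent a (Module.Baer.of_injective this)).injective
  exact Module.injective_object_of_injective_module R _

/-- The inclusion of the `a`-torsion submodule, as a natural transformation. -/
def torsionι : torsionFunctor.{v} a ⟶ 𝟭 (ModuleCat.{v} R) where
  app M := ModuleCat.ofHom (a.primaryComponent M).subtype

instance (M : ModuleCat.{v} R) : Mono ((torsionι a).app M) :=
  (ModuleCat.mono_iff_injective _).2 (Submodule.subtype_injective _)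

lemma exists_comp_torsionι {N : ModuleCat.{v} R} (hN : IsIdealTorsion a N) {M : ModuleCat.{v} R}
    (f : N ⟶ M) : ∃ g : N ⟶ (torsionFunctor a).obj M, g ≫ (torsionι a).app M = f :=
  ⟨ModuleCat.ofHom (f.hom.codRestrict (a.primaryComponent M)
    fun x => Ideal.primaryComponent_map_mem a f.hom ⟨x, hN ▸ Submodule.mem_top⟩), rfl⟩

end LocalCoh

/-! ### Maps from a single complex to a K-injective complex. -/

namespace CochainComplex.IsKInjective

open HomComplex DerivedCategory

variable {C : Type u} [Category.{v} C] [Abelian C] [HasDerivedCategory.{w} C]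

/-- Morphisms in the derived category from a single complex to a shifted K-injective complex are
represented by cocycles. -/
lemma exists_Q_map_fromSingleMk (N : C) (L : CochainComplex C ℤ) [L.IsKInjective] (n : ℤ)
    (x : Q.obj ((singleFunctor C 0).obj N) ⟶ Q.obj (L⟦n⟧)) :
    ∃ (f : N ⟶ L.X n) (hf : f ≫ L.d n (n + 1) = 0),
      Q.map
        (Cocycle.equivHomShift.symm (Cocycle.fromSingleMk f (zero_add n) (n + 1) rfl hf)) = x := by
  obtain ⟨y, hy⟩ := (Qh_map_bijective _ (L⟦n⟧)).surjective
    ((quotientCompQhIso C).hom.app _ ≫ x ≫ (quotientCompQhIso C).inv.app _)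
  obtain ⟨g, rfl⟩ := (HomotopyCategory.quotient _ _).map_surjective y
  obtain ⟨c, rfl⟩ := Cocycle.equivHomShift.symm.surjective g
  obtain ⟨f, hf, rfl⟩ := Cocycle.fromSingleMk_surjective c n (zero_add n) (n + 1) rfl
  refine ⟨f, hf, ?_⟩
  rw [← cancel_epi ((quotientCompQhIso C).hom.app _), ← quotientCompQhIso_hom_naturality, hy]
  erw [Category.assoc, Category.assoc, (quotientCompQhIso C).inv_hom_id_app (L⟦n⟧)]
  exact congrArg _ (Category.comp_id x)

/-- K-injectivity makes vanishing in the derived category the same as being null-homotopic, i.e. the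
cocycle is a coboundary. -/
lemma Q_map_fromSingleMk_eq_zero_iff (N : C) (L : CochainComplex C ℤ) [L.IsKInjective] (n : ℤ)
    (f : N ⟶ L.X n) (hf : f ≫ L.d n (n + 1) = 0) :
    Q.map
      (Cocycle.equivHomShift.symm (Cocycle.fromSingleMk f (zero_add n) (n + 1) rfl hf)) = 0 ↔
      ∃ g : N ⟶ L.X (n - 1), g ≫ L.d (n - 1) n = f := by
  rw [← Cocycle.fromSingleMk_mem_coboundaries_iff f (zero_add n) (n + 1) rfl hf (n - 1) (by lia),
    ← CohomologyClass.toHom_mk_eq_zero_iff, CohomologyClass.toHom_mk,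
    ← (Qh_map_bijective _ (L⟦n⟧)).injective.eq_iff, Functor.map_zero]
  have h := quotientCompQhIso_hom_naturality
    (Cocycle.equivHomShift.symm (Cocycle.fromSingleMk f (zero_add n) (n + 1) rfl hf))
  refine ⟨fun hz => ?_, fun hz => ?_⟩
  · rw [hz, Limits.comp_zero] at h
    rwa [← cancel_mono ((quotientCompQhIso C).hom.app (L⟦n⟧)), Limits.zero_comp]
  · rw [hz, Limits.zero_comp] at h
    rw [← cancel_epi ((quotientCompQhIso C).hom.app _), ← h, Limits.comp_zero]

/-- Let `φ : K ⟶ L` be a morphism of K-injective complexes which is a monomorphism in each degree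
and such that all morphisms from `N` to the components of `L` factor through `K`. Then `φ`
induces bijections on morphisms from `N` in the derived category. -/
lemma bijective_comp_Q_map {N : C} {K L : CochainComplex C ℤ} [K.IsKInjective] [L.IsKInjective]
    (φ : K ⟶ L) [∀ n, Mono (φ.f n)]
    (hφ : ∀ (n : ℤ) (f : N ⟶ L.X n), ∃ g : N ⟶ K.X n, g ≫ φ.f n = f) (n : ℤ) :
    Function.Bijective (fun f : Q.obj ((singleFunctor C 0).obj N) ⟶
      Q.obj (K⟦n⟧) => f ≫ Q.map (φ⟦n⟧')) := by
  have key (f : N ⟶ K.X n) (hf : f ≫ K.d n (n + 1) = 0) :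
      Q.map (Cocycle.equivHomShift.symm
        (Cocycle.fromSingleMk f (zero_add n) (n + 1) rfl hf)) ≫ Q.map (φ⟦n⟧') =
      Q.map (Cocycle.equivHomShift.symm
        (Cocycle.fromSingleMk (f ≫ φ.f n) (zero_add n) (n + 1) rfl
          (by rw [Category.assoc, φ.comm, reassoc_of% hf, Limits.zero_comp]))) := by
    rw [← Functor.map_comp, Cocycle.fromSingleMk_postcomp _ _ _ _ hf,
      Cocycle.equivHomShift_symm_postcomp]
  constructor
  · intro x y hxy
    rw [← sub_eq_zero]
    have hz : (x - y) ≫ Q.map (φ⟦n⟧') = 0 := by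
      rw [Preadditive.sub_comp, sub_eq_zero]; exact hxy
    generalize x - y = z at hz
    obtain ⟨f, hf, rfl⟩ := exists_Q_map_fromSingleMk N K n z
    rw [key, Q_map_fromSingleMk_eq_zero_iff] at hz
    obtain ⟨g, hg⟩ := hz
    -- The bounding map itself lifts to `K`; the mono `φ.f n` then reflects the coboundary relation.
    obtain ⟨g, rfl⟩ := hφ _ g
    rw [Q_map_fromSingleMk_eq_zero_iff]
    refine ⟨g, ?_⟩
    rw [← cancel_mono (φ.f n), ← hg, Category.assoc, Category.assoc, φ.comm]
  · intro y
    obtain ⟨f, hf, rfl⟩ := exists_Q_map_fromSingleMk N L n y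
    obtain ⟨g, rfl⟩ := hφ _ f
    have hg : g ≫ K.d n (n + 1) = 0 := by
      rw [← cancel_mono (φ.f (n + 1)), Category.assoc, ← φ.comm, ← Category.assoc, hf,
        Limits.zero_comp]
    exact ⟨_, key g hg⟩

end CochainComplex.IsKInjective

/-! ### Long exact Hom sequences of a triangle. -/

namespace CategoryTheory.Pretriangulated

open Limits Triangle

variable {C : Type u} [Category.{v} C] [HasShift C ℤ]

lemma subsingleton_hom_shift_shift_iff (A X : C) (a b c : ℤ) (h : a + b = c) :
    Subsingleton (A ⟶ X⟦a⟧⟦b⟧) ↔ Subsingleton (A ⟶ X⟦c⟧) :=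
  (((Iso.refl A).homCongr ((shiftFunctorAdd' C a b c h).app X))).subsingleton_congr.symm

variable [Preadditive C] [HasZeroObject C] [∀ n : ℤ, (shiftFunctor C n).Additive] [Pretriangulated C]

lemma subsingleton_hom_shift_obj₂ {T : Triangle C} (hT : T ∈ distTriang C) (A : C) (n : ℤ)
    [Subsingleton (A ⟶ T.obj₁⟦n⟧)] [Subsingleton (A ⟶ T.obj₃⟦n⟧)] :
    Subsingleton (A ⟶ T.obj₂⟦n⟧) := by
  refine subsingleton_of_forall_eq 0 fun f => ?_
  obtain ⟨g, hg⟩ := coyoneda_exact₂ _ (shift_distinguished T hT n) f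
    (Subsingleton.elim (α := (A ⟶ T.obj₃⟦n⟧)) _ _)
  rw [hg, Subsingleton.elim (α := (A ⟶ T.obj₁⟦n⟧)) g 0]
  exact zero_comp

lemma bijective_comp_shift_mor₂ {T : Triangle C} (hT : T ∈ distTriang C) (A : C) (n : ℤ)
    [Subsingleton (A ⟶ T.obj₁⟦n⟧)] [h : Subsingleton (A ⟶ T.obj₁⟦n + 1⟧)] :
    Function.Bijective (fun f : A ⟶ T.obj₂⟦n⟧ => f ≫ T.mor₂⟦n⟧') := by
  have hT' := shift_distinguished T hT n
  constructor
  · intro x y hxy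
    -- Shifting a triangle by `n` multiplies its maps by the sign (-1)^n.
    have hxy' : (x - y) ≫ (n.negOnePow • T.mor₂⟦n⟧') = 0 := by
      rw [Linear.comp_units_smul, Preadditive.sub_comp, sub_eq_zero.2 hxy, smul_zero]
    obtain ⟨g, hg⟩ := coyoneda_exact₂ _ hT' (x - y) hxy'
    rw [← sub_eq_zero, hg, Subsingleton.elim (α := (A ⟶ T.obj₁⟦n⟧)) g 0]
    exact zero_comp
  · intro y
    rw [← subsingleton_hom_shift_shift_iff A _ n 1 (n + 1) rfl] at h
    obtain ⟨(g : A ⟶ T.obj₂⟦n⟧), (hg : y = g ≫ (n.negOnePow • T.mor₂⟦n⟧'))⟩ :=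
      coyoneda_exact₃ _ hT' y (Subsingleton.elim (α := (A ⟶ T.obj₁⟦n⟧⟦(1 : ℤ)⟧)) _ _)
    refine ⟨n.negOnePow • g, ?_⟩
    simp only [hg, Linear.comp_units_smul, Linear.units_smul_comp]

/-- The inverse rotation starts with `T.obj₃⟦-1⟧`, so degrees n and n + 1 there are n - 1 and n for
`T.obj₃`. -/
lemma bijective_comp_shift_mor₁ {T : Triangle C} (hT : T ∈ distTriang C) (A : C) (n : ℤ)
    [Subsingleton (A ⟶ T.obj₃⟦n⟧)] [Subsingleton (A ⟶ T.obj₃⟦n - 1⟧)] :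
    Function.Bijective (fun f : A ⟶ T.obj₁⟦n⟧ => f ≫ T.mor₁⟦n⟧') := by
  have : Subsingleton (A ⟶ T.invRotate.obj₁⟦n⟧) :=
    (subsingleton_hom_shift_shift_iff A T.obj₃ (-1) n (n - 1) (by lia)).2 inferInstance
  have : Subsingleton (A ⟶ T.invRotate.obj₁⟦n + 1⟧) :=
    (subsingleton_hom_shift_shift_iff A T.obj₃ (-1) (n + 1) n (by lia)).2 inferInstance
  exact bijective_comp_shift_mor₂ (inv_rot_of_distTriang _ hT) A n

end CategoryTheory.Pretriangulated

/-! ### Dévissage along canonical truncations. -/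

namespace DerivedCategory

open Limits Pretriangulated TStructure

variable {C : Type u} [Category.{v} C] [Abelian C] [HasDerivedCategory.{w} C]

/-- An object concentrated in degree `i` is the single complex on its homology. -/
lemma nonempty_iso_single_homology (Y : DerivedCategory C) (i : ℤ) [Y.IsGE i] [Y.IsLE i] :
    Nonempty (Y ≅ (singleFunctor C i).obj ((homologyFunctor C i).obj Y)) := by
  obtain ⟨M, ⟨e⟩⟩ := exists_iso_singleFunctor_obj_of_isGE_of_isLE Y i
  exact ⟨e ≪≫ (singleFunctor C i).mapIso (((singleFunctorCompHomologyFunctorIso C i).app M).symm ≪≫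
    (homologyFunctor C i).mapIso e.symm)⟩

lemma isIso_homology_truncLTι (Y : DerivedCategory C) (b i : ℤ) (h : i < b) :
    IsIso ((homologyFunctor C i).map ((t.truncLTι b).app Y)) := by
  have hT := t.triangleLTGE_distinguished b Y
  have : Mono ((homologyFunctor C i).map ((t.truncLTι b).app Y)) :=
    (HomologySequence.mono_homologyMap_mor₁_iff _ hT (i - 1) i (by lia)).2
      ((isZero_of_isGE ((t.truncGE b).obj Y) b (i - 1) (by lia)).eq_of_src _ _)
  have : Epi ((homologyFunctor C i).map ((t.truncLTι b).app Y)) :=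
    (HomologySequence.epi_homologyMap_mor₁_iff _ hT i).2
      ((isZero_of_isGE ((t.truncGE b).obj Y) b i h).eq_of_tgt _ _)
  exact isIso_of_mono_of_epi _

lemma isIso_homology_truncGEπ (Y : DerivedCategory C) (b i : ℤ) (h : b ≤ i) :
    IsIso ((homologyFunctor C i).map ((t.truncGEπ b).app Y)) := by
  have hT := t.triangleLTGE_distinguished b Y
  have : Mono ((homologyFunctor C i).map ((t.truncGEπ b).app Y)) :=
    (HomologySequence.mono_homologyMap_mor₂_iff _ hT i).2
      ((isZero_of_isLE ((t.truncLT b).obj Y) (b - 1) i (by lia)).eq_of_src _ _)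
  have : Epi ((homologyFunctor C i).map ((t.truncGEπ b).app Y)) :=
    (HomologySequence.epi_homologyMap_mor₂_iff _ hT i (i + 1)).2
      ((isZero_of_isLE ((t.truncLT b).obj Y) (b - 1) (i + 1) (by lia)).eq_of_tgt _ _)
  exact isIso_of_mono_of_epi _

/-- The truncation of `Y` to degrees `≥ i` and `≤ i`. -/
lemma nonempty_truncLT_iso_single (Y : DerivedCategory C) (i : ℤ) [Y.IsGE i] :
    Nonempty ((t.truncLT (i + 1)).obj Y ≅
      (singleFunctor C i).obj ((homologyFunctor C i).obj Y)) := by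
  have : ((t.truncLT (i + 1)).obj Y).IsLE i := inferInstance
  have : ((t.truncLT (i + 1)).obj Y).IsGE i := by infer_instance
  have := isIso_homology_truncLTι Y (i + 1) i (by lia)
  obtain ⟨e⟩ := nonempty_iso_single_homology ((t.truncLT (i + 1)).obj Y) i
  exact ⟨e ≪≫ (singleFunctor C i).mapIso
    (asIso ((homologyFunctor C i).map ((t.truncLTι (i + 1)).app Y)))⟩

lemma subsingleton_hom_shift_congr (A : DerivedCategory C) {X Y : DerivedCategory C} (e : X ≅ Y)
    (n : ℤ) : Subsingleton (A ⟶ X⟦n⟧) ↔ Subsingleton (A ⟶ Y⟦n⟧) :=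
  ((Iso.refl A).homCongr ((shiftFunctor _ n).mapIso e)).subsingleton_congr

/-- Morphisms from an object in degrees `≤ 0` to an object in degrees `≥ i` shifted by `n < i`
vanish. -/
lemma subsingleton_hom_shift_of_lt (A Y : DerivedCategory C) [A.IsLE 0] (n i : ℤ) [Y.IsGE i]
    (hi : n < i) : Subsingleton (A ⟶ Y⟦n⟧) := by
  have : (Y⟦n⟧).IsGE (i - n) := t.isGE_shift Y i n (i - n)
  exact subsingleton_of_forall_eq 0 fun f => t.zero f 0 (i - n)

/-- If `A` is in degrees `≤ 0` and `Y` is bounded below, then there are no nonzero morphisms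
`A ⟶ Y⟦n⟧` as soon as there are none to the shifts of the homology objects of `Y`. -/
lemma subsingleton_hom_shift_of_homology (A : DerivedCategory C) [A.IsLE 0] (n : ℤ)
    (Y : DerivedCategory C) (i : ℤ) [Y.IsGE i]
    (h : ∀ j : ℤ, i ≤ j → j ≤ n →
      Subsingleton (A ⟶ ((singleFunctor C j).obj ((homologyFunctor C j).obj Y))⟦n⟧)) :
    Subsingleton (A ⟶ Y⟦n⟧) := by
  -- Induction on a bound `k` for the number of degrees from `i` to `n`; each step splits off the
  -- lowest homology.
  obtain ⟨k, hk⟩ : ∃ k : ℕ, n < i + k := ⟨(n - i + 1).toNat, by lia⟩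
  induction k generalizing i Y with
  | zero => exact subsingleton_hom_shift_of_lt A Y n i (by lia)
  | succ k hrec =>
    by_cases hi : n < i
    · exact subsingleton_hom_shift_of_lt A Y n i hi
    have hT := t.triangleLTGE_distinguished (i + 1) Y
    have : Subsingleton (A ⟶ ((t.triangleLTGE (i + 1)).obj Y).obj₁⟦n⟧) :=
      (subsingleton_hom_shift_congr A (nonempty_truncLT_iso_single Y i).some n).2
        (h i le_rfl (by lia))
    have : Subsingleton (A ⟶ ((t.triangleLTGE (i + 1)).obj Y).obj₃⟦n⟧) := by
      refine hrec ((t.truncGE (i + 1)).obj Y) (i + 1) (fun j hij hj => ?_) (by push_cast at hk; lia)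
      have := isIso_homology_truncGEπ Y (i + 1) j hij
      exact (subsingleton_hom_shift_congr A ((singleFunctor C j).mapIso
        (asIso ((homologyFunctor C j).map ((t.truncGEπ (i + 1)).app Y)))) n).1
        (h j (by lia) hj)
    exact subsingleton_hom_shift_obj₂ hT A n

/-- If `A` is in degrees `≤ 0`, and `Y` in degrees `≥ 0`, then `Hom(A, Y⟦n⟧)` is given by a single
homology object of `Y` if the other ones do not contribute in the neighbouring degrees. -/
lemma nonempty_linearEquiv_hom_shift (R : Type*) [Ring R] [Linear R C]
    (A Y : DerivedCategory C) [A.IsLE 0] [Y.IsGE 0] (n p : ℤ) (hp : 0 ≤ p)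
    (h₁ : ∀ j : ℤ, 0 ≤ j → j ≤ n → j ≠ p →
      Subsingleton (A ⟶ ((singleFunctor C j).obj ((homologyFunctor C j).obj Y))⟦n⟧))
    (h₂ : ∀ j : ℤ, 0 ≤ j → j < p →
      Subsingleton (A ⟶ ((singleFunctor C j).obj ((homologyFunctor C j).obj Y))⟦n + 1⟧))
    (h₃ : ∀ j : ℤ, p < j → j < n →
      Subsingleton (A ⟶ ((singleFunctor C j).obj ((homologyFunctor C j).obj Y))⟦n - 1⟧)) :
    Nonempty ((A ⟶ ((singleFunctor C p).obj ((homologyFunctor C p).obj Y))⟦n⟧) ≃ₗ[R]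
      (A ⟶ Y⟦n⟧)) := by
  -- `Y₁`, `Y₂`, `Y₃` carry the homology of `Y` in degrees < p, ≥ p and > p.
  let Y₁ := (t.truncLT p).obj Y
  let Y₂ := (t.truncGE p).obj Y
  let Y₃ := (t.truncGE (p + 1)).obj Y₂
  have : Y₁.IsGE 0 := by dsimp only [Y₁]; infer_instance
  have hY₁ (m : ℤ) (hm : ∀ j : ℤ, 0 ≤ j → j ≤ m → j < p →
      Subsingleton (A ⟶ ((singleFunctor C j).obj ((homologyFunctor C j).obj Y))⟦m⟧)) :
      Subsingleton (A ⟶ Y₁⟦m⟧) := by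
    refine subsingleton_hom_shift_of_homology A m Y₁ 0 fun j hj hjm => ?_
    by_cases hjp : j < p
    · have := isIso_homology_truncLTι Y p j hjp
      exact (subsingleton_hom_shift_congr A ((singleFunctor C j).mapIso
        (asIso ((homologyFunctor C j).map ((t.truncLTι p).app Y)))) m).2 (hm j hj hjm hjp)
    · have hz : IsZero ((homologyFunctor C j).obj Y₁) := isZero_of_isLE Y₁ (p - 1) j (by lia)
      exact ⟨((shiftFunctor _ m).map_isZero ((singleFunctor C j).map_isZero hz)).eq_of_tgt⟩
  have hY₃ (m : ℤ) (hm : ∀ j : ℤ, p < j → j ≤ m →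
      Subsingleton (A ⟶ ((singleFunctor C j).obj ((homologyFunctor C j).obj Y))⟦m⟧)) :
      Subsingleton (A ⟶ Y₃⟦m⟧) := by
    refine subsingleton_hom_shift_of_homology A m Y₃ (p + 1) fun j hj hjm => ?_
    have := isIso_homology_truncGEπ Y p j (by lia)
    have := isIso_homology_truncGEπ Y₂ (p + 1) j hj
    exact (subsingleton_hom_shift_congr A ((singleFunctor C j).mapIso
      (asIso ((homologyFunctor C j).map ((t.truncGEπ p).app Y)) ≪≫
        asIso ((homologyFunctor C j).map ((t.truncGEπ (p + 1)).app Y₂)))) m).1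
      (hm j (by lia) hjm)
  have hT := t.triangleLTGE_distinguished p Y
  have hT' := t.triangleLTGE_distinguished (p + 1) Y₂
  have : Subsingleton (A ⟶ ((t.triangleLTGE p).obj Y).obj₁⟦n⟧) :=
    hY₁ n fun j hj hjn hjp => h₁ j hj hjn hjp.ne
  have : Subsingleton (A ⟶ ((t.triangleLTGE p).obj Y).obj₁⟦n + 1⟧) :=
    hY₁ (n + 1) fun j hj _ hjp => h₂ j hj hjp
  have : Subsingleton (A ⟶ ((t.triangleLTGE (p + 1)).obj Y₂).obj₃⟦n⟧) :=
    hY₃ n fun j hj hjn => h₁ j (by lia) hjn hj.ne'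
  -- Only homology in degrees ≤ n - 1 can contribute here, whence the strict bound `j < n` in `h₃`.
  have : Subsingleton (A ⟶ ((t.triangleLTGE (p + 1)).obj Y₂).obj₃⟦n - 1⟧) :=
    hY₃ (n - 1) fun j hj hjn => h₃ j hj (by lia)
  let e₁ : (A ⟶ Y⟦n⟧) ≃ₗ[R] (A ⟶ Y₂⟦n⟧) :=
    LinearEquiv.ofBijective (Linear.rightComp R A _) (bijective_comp_shift_mor₂ hT A n)
  let e₂ : (A ⟶ ((t.truncLT (p + 1)).obj Y₂)⟦n⟧) ≃ₗ[R] (A ⟶ Y₂⟦n⟧) :=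
    LinearEquiv.ofBijective (Linear.rightComp R A _) (bijective_comp_shift_mor₁ hT' A n)
  have := isIso_homology_truncGEπ Y p p le_rfl
  let e : (singleFunctor C p).obj ((homologyFunctor C p).obj Y) ≅
      (t.truncLT (p + 1)).obj Y₂ :=
    (singleFunctor C p).mapIso (asIso ((homologyFunctor C p).map ((t.truncGEπ p).app Y))) ≪≫
      (nonempty_truncLT_iso_single Y₂ p).some.symm
  exact ⟨(Linear.homCongr R (Iso.refl A) ((shiftFunctor _ n).mapIso e)).trans
    (e₂.trans e₁.symm)⟩

end DerivedCategory

/-! ### Ext as Hom in the derived category. -/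

namespace DerivedCategory

open Limits

variable {C : Type u} [Category.{v} C] [Abelian C] [HasExt.{w} C] [HasDerivedCategory.{w'} C]

/-- `Ext`-modules as morphisms to a shifted single complex placed in an arbitrary degree. -/
lemma nonempty_extLinearEquiv (R : Type*) [Ring R] [Linear R C] (N M : C) (i m : ℤ) (k : ℕ)
    (h : m - k = i) :
    Nonempty (Abelian.Ext.{w} N M k ≃ₗ[R]
      ((singleFunctor C 0).obj N ⟶ ((singleFunctor C i).obj M)⟦m⟧)) := by
  -- Both sides are `M` placed in degree -k = i - m.
  let e : ((singleFunctor C 0).obj M)⟦(k : ℤ)⟧ ≅ ((singleFunctor C i).obj M)⟦m⟧ :=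
    ((singleFunctors C).shiftIso (k : ℤ) (-k) 0 (by lia)).app M ≪≫
      (((singleFunctors C).shiftIso m (-k) i (by lia)).app M).symm
  exact ⟨Abelian.Ext.homLinearEquiv.trans (Linear.homCongr R (Iso.refl _) e)⟩

end DerivedCategory

/-! ### Applying a subfunctor of the identity to an injective resolution. -/

namespace CategoryTheory.InjectiveResolution

variable {C : Type u} [Category.{v} C] [Abelian C] {D : Type*} [Category* D] [Abelian D]
  {X : C} (I : InjectiveResolution X) (F : C ⥤ D) [F.Additive]

/-- The image under an additive functor of an injective resolution, as a complex
indexed by `ℤ`. -/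
noncomputable def mapCochainComplex : CochainComplex D ℤ :=
  ((F.mapHomologicalComplex _).obj I.cocomplex).extend ComplexShape.embeddingUpNat

instance : (I.mapCochainComplex F).IsStrictlyGE 0 := by
  dsimp [mapCochainComplex]
  infer_instance

/-- The components of `mapCochainComplex` in nonnegative degrees. -/
noncomputable def mapCochainComplexXIso (n : ℤ) (k : ℕ) (h : k = n) :
    (I.mapCochainComplex F).X n ≅ F.obj (I.cocomplex.X k) :=
  HomologicalComplex.extendXIso _ _ h

lemma injective_mapCochainComplex_X [∀ k, Injective (F.obj (I.cocomplex.X k))] (n : ℤ) :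
    Injective ((I.mapCochainComplex F).X n) := by
  by_cases hn : 0 ≤ n
  · obtain ⟨k, rfl⟩ := Int.eq_ofNat_of_zero_le hn
    exact Injective.of_iso (I.mapCochainComplexXIso F _ _ rfl).symm inferInstance
  · exact (CochainComplex.isZero_of_isStrictlyGE _ 0 _ (by lia)).injective

/-- The homology of `mapCochainComplex` is given by the right derived functors. -/
noncomputable def mapCochainComplexHomologyIso [HasInjectiveResolutions C] (n : ℕ) :
    (I.mapCochainComplex F).homology n ≅ (F.rightDerived n).obj X :=
  HomologicalComplex.extendHomologyIso _ _ rfl ≪≫ (I.isoRightDerivedObj F n).symm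

variable {F : C ⥤ C} [F.Additive] (α : F ⟶ 𝟭 C)

/-- The morphism to an injective resolution induced by a natural transformation to
the identity functor. -/
noncomputable def mapCochainComplexι : I.mapCochainComplex F ⟶ I.cochainComplex :=
  HomologicalComplex.extendMap
    (K := (F.mapHomologicalComplex _).obj I.cocomplex) (L := I.cocomplex)
    { f k := α.app (I.cocomplex.X k)
      comm' i j _ := (α.naturality (I.cocomplex.d i j)).symm } ComplexShape.embeddingUpNat

lemma mapCochainComplexι_f (n : ℤ) (k : ℕ) (h : k = n) :
    (I.mapCochainComplexι α).f n = (I.mapCochainComplexXIso F n k h).hom ≫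
      α.app (I.cocomplex.X k) ≫ (I.cochainComplexXIso n k h).inv :=
  HomologicalComplex.extendMap_f _ _ h

instance [∀ M, Mono (α.app M)] (n : ℤ) : Mono ((I.mapCochainComplexι α).f n) := by
  by_cases hn : 0 ≤ n
  · obtain ⟨k, rfl⟩ := Int.eq_ofNat_of_zero_le hn
    rw [I.mapCochainComplexι_f α _ k rfl]
    infer_instance
  · exact ⟨fun _ _ _ => (CochainComplex.isZero_of_isStrictlyGE _ 0 _ (by lia)).eq_of_tgt _ _⟩

lemma exists_comp_mapCochainComplexι_f {N : C}
    (hN : ∀ (M : C) (f : N ⟶ M), ∃ g : N ⟶ F.obj M, g ≫ α.app M = f) (n : ℤ)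
    (f : N ⟶ I.cochainComplex.X n) :
    ∃ g : N ⟶ (I.mapCochainComplex F).X n, g ≫ (I.mapCochainComplexι α).f n = f := by
  by_cases hn : 0 ≤ n
  · obtain ⟨k, rfl⟩ := Int.eq_ofNat_of_zero_le hn
    obtain ⟨g, hg⟩ := hN _ (f ≫ (I.cochainComplexXIso _ k rfl).hom)
    refine ⟨g ≫ (I.mapCochainComplexXIso F _ k rfl).inv, ?_⟩
    rw [I.mapCochainComplexι_f α _ k rfl, Category.assoc, Iso.inv_hom_id_assoc, reassoc_of% hg,
      Iso.hom_inv_id, Category.comp_id]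
  · exact ⟨0, (CochainComplex.isZero_of_isStrictlyGE _ 0 _ (by lia)).eq_of_tgt _ _⟩

open _root_.DerivedCategory in
/-- Let `F` be a subfunctor of the identity functor which preserves injective objects. If
all morphisms from `N` factor through `F`, then `Ext N X n` can be computed using
the derived functor of `F`. -/
lemma nonempty_extLinearEquiv_mapCochainComplex [HasExt.{w} C] [HasDerivedCategory.{w'} C]
    (R : Type*) [Ring R] [Linear R C] [∀ k, Injective (F.obj (I.cocomplex.X k))]
    [∀ M, Mono (α.app M)] {N : C}
    (hN : ∀ (M : C) (f : N ⟶ M), ∃ g : N ⟶ F.obj M, g ≫ α.app M = f) (n : ℕ) :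
    Nonempty (((singleFunctor C 0).obj N ⟶ (Q.obj (I.mapCochainComplex F))⟦(n : ℤ)⟧) ≃ₗ[R]
      Abelian.Ext.{w} N X n) := by
  have := I.injective_mapCochainComplex_X F
  have : (I.mapCochainComplex F).IsKInjective := CochainComplex.isKInjective_of_injective _ 0
  let eN := (singleFunctorIsoCompQ C 0).app N
  let eX : Q.obj I.cochainComplex ≅ (singleFunctor C 0).obj X :=
    (asIso (Q.map I.ι')).symm ≪≫ ((singleFunctorIsoCompQ C 0).app X).symm
  let e₁ := Linear.homCongr R eN ((Q.commShiftIso (n : ℤ)).symm.app (I.mapCochainComplex F))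
  let e₂ := LinearEquiv.ofBijective
    (Linear.rightComp R (Q.obj ((CochainComplex.singleFunctor C 0).obj N))
      (Q.map ((I.mapCochainComplexι α)⟦(n : ℤ)⟧')))
    (CochainComplex.IsKInjective.bijective_comp_Q_map (I.mapCochainComplexι α)
      (I.exists_comp_mapCochainComplexι_f α hN) n)
  let e₃ := Linear.homCongr R eN.symm
    ((Q.commShiftIso (n : ℤ)).app I.cochainComplex ≪≫ (shiftFunctor _ (n : ℤ)).mapIso eX)
  exact ⟨e₁.trans (e₂.trans (e₃.trans Abelian.Ext.homLinearEquiv.symm))⟩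

end CategoryTheory.InjectiveResolution

/-! ### The main theorem. -/

theorem theorem3p5 {R : Type u} [CommRing R] [Nontrivial R] [IsNoetherianRing R] [Small.{v} R]
    (a : Ideal R)
    (N : ModuleCat.{v} R) [Module.Finite R N] (hN : LocalCoh.IsIdealTorsion a N)
    (X : ModuleCat.{v} R) (s t : ℕ)
    (h₁ : ∀ i : ℕ, i < t ∨ (t < i ∧ i ≤ s + t) →
      Subsingleton (Abelian.Ext.{v} N ((LocalCoh.localCohomologyFunctor a i).obj X) (s + t - i)))
    (h₂ : ∀ i : ℕ, i < t →
      Subsingleton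
        (Abelian.Ext.{v} N ((LocalCoh.localCohomologyFunctor a i).obj X) (s + t + 1 - i)))
    (h₃ : ∀ i : ℕ, t + 1 ≤ i ∧ i < s + t →
      Subsingleton
        (Abelian.Ext.{v} N ((LocalCoh.localCohomologyFunctor a i).obj X) (s + t - 1 - i))) :
    Nonempty (Abelian.Ext.{v} N ((LocalCoh.localCohomologyFunctor a t).obj X) s ≃ₗ[R]
      Abelian.Ext.{v} N X (s + t)) := by
  let := HasDerivedCategory.standard (ModuleCat.{v} R)
  let I : InjectiveResolution X := InjectiveResolution.of X
  let Y := DerivedCategory.Q.obj (I.mapCochainComplex (LocalCoh.torsionFunctor a))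
  let A := (DerivedCategory.singleFunctor (ModuleCat.{v} R) 0).obj N
  have eH (i : ℕ) : Nonempty ((DerivedCategory.homologyFunctor _ (i : ℤ)).obj Y ≅
      (LocalCoh.localCohomologyFunctor a i).obj X) :=
    ⟨(DerivedCategory.homologyFunctorFactors _ (i : ℤ)).app _ ≪≫
      I.mapCochainComplexHomologyIso _ i⟩
  have eExt (i k : ℕ) (m : ℤ) (h : m - k = i) :
      Nonempty (Abelian.Ext.{v} N ((LocalCoh.localCohomologyFunctor a i).obj X) k ≃ₗ[R]
        (A ⟶ ((DerivedCategory.singleFunctor _ (i : ℤ)).obj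
          ((DerivedCategory.homologyFunctor _ (i : ℤ)).obj Y))⟦m⟧)) :=
    ⟨(DerivedCategory.nonempty_extLinearEquiv R N _ i m k h).some.trans
      (Linear.homCongr R (Iso.refl _) ((shiftFunctor _ m).mapIso
        ((DerivedCategory.singleFunctor _ (i : ℤ)).mapIso (eH i).some.symm)))⟩
  obtain ⟨e⟩ := DerivedCategory.nonempty_linearEquiv_hom_shift R A Y ((s + t : ℕ) : ℤ) t
    (by lia)
    -- In all three cases the bounds on `j` keep the natural-number subtraction in the Ext degree
    -- from truncating.
    (fun j hj hjn hjt => by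
      lift j to ℕ using hj
      exact (eExt j (s + t - j) _ (by lia)).some.toEquiv.subsingleton_congr.1 (h₁ j (by lia)))
    (fun j hj hjt => by
      lift j to ℕ using hj
      exact (eExt j (s + t + 1 - j) _ (by lia)).some.toEquiv.subsingleton_congr.1 (h₂ j (by lia)))
    (fun j hj hjn => by
      lift j to ℕ using by lia
      exact (eExt j (s + t - 1 - j) _ (by lia)).some.toEquiv.subsingleton_congr.1 (h₃ j (by lia)))
  obtain ⟨e'⟩ := I.nonempty_extLinearEquiv_mapCochainComplex (LocalCoh.torsionι a) R
    (fun _ f => LocalCoh.exists_comp_torsionι a hN f) (s + t)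
  exact ⟨((eExt t s _ (by lia)).some.trans e).trans e'⟩
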